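/- A family $\mathcal{A}$ of infinite subsets of $\omega$ is almost disjoint if any two distinct members of $\mathcal{A}$ have finite intersection; a mad family is an infinite almost disjoint family that is maximal under inclusion among almost disjoint families. A family $\mathcal{A}$ is of true cardinality $\mathfrak{c}$ if for every $B\subseteq\omega$ the set $\{a\in\mathcal{A} : |a\cap B|=\omega\}$ is either finite or of cardinality $\mathfrak{c}=2^{\aleph_0}$. The Mrówka–Isbell space $\Psi(\mathcal{A})$ has underlying set the disjoint union $\omega\sqcup\mathcal{A}$; each point of $\omega$ is isolated, and the basic open neighbourhoods of $a\in\mathcal{A}$ are the sets $\{a\}\cup(a\setminus F)$ with $F\subset\omega$ finite. A subset of a topological space is regularly closed if it equals the closure of its interior. For a positive integer $n$, a regular $T_1$ space $X$ is $n$-partly-normal if, whenever $A$ is a regularly closed subset of $X$, $B$ is the intersection of at most $n$ (and at least one) regularly closed subsets of $X$, and $A\cap B=\emptyset$, there are disjoint open sets $U\supseteq A$ and $V\supseteq B$. The family $\mathcal{A}$ is called $n$-partly-normal if $\Psi(\mathcal{A})$ is. If there exists a mad family of true cardinality $\mathfrak{c}$, then for every positive integer $n$ there is a mad family of true cardinality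 $\mathfrak{c}$ that is $n$-partly-normal but not $(n+1)$-partly-normal. -/

import Mathlib

open scoped Cardinal

/-- A family of infinite subsets of `ℕ`, any two distinct members of which meet in a finite set. -/
structure IsAlmostDisjointFamily (A : Set (Set ℕ)) : Prop where
  infinite_of_mem : ∀ a ∈ A, a.Infinite
  finite_inter : ∀ a ∈ A, ∀ b ∈ A, a ≠ b → (a ∩ b).Finite

/-- A mad family: an infinite almost disjoint family that is maximal, with respect to inclusion,
among the almost disjoint families. -/
def IsMadFamily (A : Set (Set ℕ)) : Prop :=
  A.Infinite ∧ Maximal IsAlmostDisjointFamily A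

/-- The members of `A` that have infinite intersection with `B`. -/
def familyTrace (A : Set (Set ℕ)) (B : Set ℕ) : Set (Set ℕ) :=
  {a | a ∈ A ∧ (a ∩ B).Infinite}

/-- `A` is of true cardinality `𝔠`. -/
def HasTrueCardinalityContinuum (A : Set (Set ℕ)) : Prop :=
  ∀ B : Set ℕ, (familyTrace A B).Finite ∨ #(familyTrace A B) = 𝔠

/-- The underlying set of the Mrówka–Isbell space of `A`: the disjoint union of `ℕ` and `A`. -/
inductive PsiSpace (A : Set (Set ℕ)) : Type
  | nat (k : ℕ) : PsiSpace A
  | mem (a : A) : PsiSpace A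

/-- The Mrówka–Isbell topology. The points of `ℕ` are isolated, and the sets
`{a} ∪ (a \ F)`, with `F` a finite subset of `ℕ`, are the basic neighbourhoods of `a ∈ A`. -/
instance PsiSpace.instTopologicalSpace (A : Set (Set ℕ)) : TopologicalSpace (PsiSpace A) where
  IsOpen U := ∀ a : A, PsiSpace.mem a ∈ U →
    ∃ F : Finset ℕ, ∀ k ∈ (a : Set ℕ), k ∉ F → PsiSpace.nat k ∈ U
  isOpen_univ := fun _ _ => ⟨∅, fun _ _ _ => trivial⟩
  isOpen_inter := by
    intro U V hU hV a ha
    obtain ⟨F, hF⟩ := hU a ha.1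
    obtain ⟨G, hG⟩ := hV a ha.2
    refine ⟨F ∪ G, fun k hk hkn => ?_⟩
    rw [Finset.mem_union, not_or] at hkn
    exact ⟨hF k hk hkn.1, hG k hk hkn.2⟩
  isOpen_sUnion := by
    intro S hS a ha
    obtain ⟨U, hU, haU⟩ := ha
    obtain ⟨F, hF⟩ := hS U hU a haU
    exact ⟨F, fun k hk hkn => ⟨U, hU, hF k hk hkn⟩⟩

/-- A regularly closed set (closed domain): a set equal to the closure of its interior. -/
def IsRegularlyClosed {X : Type*} [TopologicalSpace X] (C : Set X) : Prop :=
  C = closure (interior C)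

/-- `B` is the intersection of at most `n` (and at least one) regularly closed sets. -/
def IsInterOfAtMostRegularlyClosed {X : Type*} [TopologicalSpace X] (n : ℕ) (B : Set X) : Prop :=
  ∃ m : ℕ, 1 ≤ m ∧ m ≤ n ∧
    ∃ D : Fin m → Set X, (∀ i, IsRegularlyClosed (D i)) ∧ B = ⋂ i, D i

/-- An `n`-partly-normal space: a regular (and `T₁`) space in which every regularly closed set can
be separated by open sets from every set disjoint from it that is the intersection of at most `n`
regularly closed sets. -/
structure IsPartlyNormalOfOrder (n : ℕ) (X : Type*) [TopologicalSpace X] : Prop where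
  regular : T3Space X
  separated : ∀ C B : Set X, IsRegularlyClosed C → IsInterOfAtMostRegularlyClosed n B →
    Disjoint C B → SeparatedNhds C B

-- Separation in the Mrówka–Isbell space is governed by traces. A closed set containing only
-- finitely many members of the family can be separated from every closed set disjoint from it, so
-- only sets with infinite trace can obstruct normality. It therefore suffices to find a mad family
-- in which any n+1 sets with infinite traces have a common trace member, while some n+2 pairwise
-- disjoint sets with infinite traces have none (`exists_isMadFamily_forall_exists_infinite_inter`).
-- The first property forces `C` and `D 1, ..., D n` with infinite traces to intersect; the two
-- together refute (n+1)-partial normality.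
--
-- To build it, put a copy of the given family on each residue class modulo n+2. For each of the at
-- most 𝔠 tuples of n+1 sets with infinite traces, choose one trace member per entry, all choices
-- distinct, and unite the chosen members; true cardinality 𝔠 leaves room for this. A block has at
-- most n+1 pieces, each inside one residue class, so it misses some class.

universe u

/-- Transfinite recursion along a well-order of least possible type: fewer than `#ι` values are used
before stage `i`, so `S i` still has an unused element. -/
theorem Cardinal.exists_injective_forall_mem {ι α : Type u} (S : ι → Set α)
    (hS : ∀ i, #ι ≤ #(S i)) :
    ∃ f : ι → α, Function.Injective f ∧ ∀ i, f i ∈ S i := by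
  obtain ⟨_, _, hord⟩ := Cardinal.exists_ord_eq_type_lt ι
  have key : ∀ (i : ι) (g : (j : ι) → j < i → α),
      ∃ x ∈ S i, ∀ (j : ι) (hj : j < i), g j hj ≠ x := by
    intro i g
    by_contra! hcon
    have hsub : S i ⊆ Set.range fun j : Set.Iio i => g j j.2 := by
      intro x hx
      obtain ⟨j, hj, rfl⟩ := hcon x hx
      exact ⟨⟨j, hj⟩, rfl⟩
    exact ((hS i).trans ((Cardinal.mk_le_mk_of_subset hsub).trans Cardinal.mk_range_le)).not_gt
      (Cardinal.mk_Iio_lt i hord)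
  choose next hmem hne using key
  have wf : WellFounded ((· < ·) : ι → ι → Prop) := wellFounded_lt
  have hfix : ∀ i, wf.fix next i = next i fun j _ => wf.fix next j := fun i => wf.fix_eq next i
  have hlt : ∀ i j, j < i → wf.fix next j ≠ wf.fix next i := by
    intro i j hj
    rw [hfix i]
    exact hne i (fun j _ => wf.fix next j) j hj
  refine ⟨wf.fix next, fun i j hij => ?_, fun i => ?_⟩
  · rcases lt_trichotomy i j with h | h | h
    · exact absurd hij (hlt j i h)
    · exact h
    · exact absurd hij.symm (hlt i j h)
  · rw [hfix i]
    exact hmem i _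

/-! ### Traces, maximality and true cardinality -/

theorem familyTrace_union (A : Set (Set ℕ)) (B C : Set ℕ) :
    familyTrace A (B ∪ C) = familyTrace A B ∪ familyTrace A C := by
  ext a
  simp only [familyTrace, Set.mem_ofPred_eq, Set.mem_union, Set.inter_union_distrib_left,
    Set.infinite_union, and_or_left]

theorem isMadFamily_iff {A : Set (Set ℕ)} :
    IsMadFamily A ↔ A.Infinite ∧ IsAlmostDisjointFamily A ∧
      ∀ B : Set ℕ, B.Infinite → (familyTrace A B).Nonempty := by
  refine and_congr_right fun _ => ⟨fun h => ⟨h.prop, fun B hB => ?_⟩, fun ⟨hA, h⟩ => ⟨hA, ?_⟩⟩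
  · by_contra hne
    have hfin : ∀ a ∈ A, (a ∩ B).Finite := fun a ha => by
      by_contra hab
      exact hne ⟨a, ha, hab⟩
    have had : IsAlmostDisjointFamily (insert B A) := by
      refine ⟨?_, ?_⟩
      · rintro a (rfl | ha)
        exacts [hB, h.prop.infinite_of_mem a ha]
      · rintro a (rfl | ha) b (rfl | hb) hab
        · exact absurd rfl hab
        · exact Set.inter_comm b a ▸ hfin b hb
        · exact hfin a ha
        · exact h.prop.finite_inter a ha b hb hab
    have hBA : B ∈ A := h.le_of_ge had (Set.subset_insert B A) (Set.mem_insert B A)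
    exact hB (Set.inter_self B ▸ hfin B hBA)
  · intro C hC hAC b hb
    obtain ⟨a, ha, hab⟩ := h b (hC.infinite_of_mem b hb)
    by_contra hbA
    exact hab (hC.finite_inter a (hAC ha) b hb fun e => hbA (e ▸ ha))

theorem hasTrueCardinalityContinuum_iff {A : Set (Set ℕ)} :
    HasTrueCardinalityContinuum A ↔
      ∀ B : Set ℕ, (familyTrace A B).Infinite → 𝔠 ≤ #(familyTrace A B) := by
  refine forall_congr' fun B => ?_
  have hle : #(familyTrace A B) ≤ 𝔠 := (Cardinal.mk_set_le _).trans (by simp)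
  rw [Set.Infinite, ← or_iff_not_imp_left, le_antisymm_iff, and_iff_right hle]

/-! ### Copies of a mad family on residue classes -/

section Copies

/-- The `N` copies of the members of `A`, one on each residue class modulo `N`. -/
def residueCopies (A : Set (Set ℕ)) (N : ℕ) : Set (Set ℕ) :=
  {c | ∃ a ∈ A, ∃ i < N, c = (fun k => N * k + i) '' a}

variable {A : Set (Set ℕ)} {N : ℕ}

theorem injective_mul_add (hN : 0 < N) (i : ℕ) : Function.Injective fun k => N * k + i := by
  intro a b h
  exact Nat.eq_of_mul_eq_mul_left hN (by simpa using h)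

theorem image_mul_add_subset {i : ℕ} (hi : i < N) (a : Set ℕ) :
    (fun k => N * k + i) '' a ⊆ {m | m % N = i} := by
  rintro _ ⟨k, _, rfl⟩
  simp [Nat.mod_eq_of_lt hi]

theorem infinite_image_inter_iff (hN : 0 < N) (i : ℕ) (a B : Set ℕ) :
    ((fun k => N * k + i) '' a ∩ B).Infinite ↔ (a ∩ (fun k => N * k + i) ⁻¹' B).Infinite := by
  rw [← Set.image_inter_preimage, Set.infinite_image_iff (injective_mul_add hN i).injOn]

theorem image_subset_familyTrace_residueCopies (hN : 0 < N) {i : ℕ} (hi : i < N) (B : Set ℕ) :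
    Set.image (fun k => N * k + i) '' familyTrace A ((fun k => N * k + i) ⁻¹' B) ⊆
      familyTrace (residueCopies A N) B := by
  rintro _ ⟨a, ha, rfl⟩
  exact ⟨⟨a, ha.1, i, hi, rfl⟩, (infinite_image_inter_iff hN i a B).2 ha.2⟩

theorem familyTrace_residueCopies (hN : 0 < N) (B : Set ℕ) :
    familyTrace (residueCopies A N) B =
      ⋃ i ∈ Set.Iio N, Set.image (fun k => N * k + i) ''
        familyTrace A ((fun k => N * k + i) ⁻¹' B) := by
  refine Set.Subset.antisymm ?_ (Set.iUnion₂_subset fun i hi =>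
    image_subset_familyTrace_residueCopies hN hi B)
  rintro _ ⟨⟨a, ha, i, hi, rfl⟩, hB⟩
  exact Set.mem_biUnion (show i ∈ Set.Iio N from hi)
    ⟨a, ⟨ha, (infinite_image_inter_iff hN i a B).1 hB⟩, rfl⟩

theorem IsMadFamily.residueCopies (hA : IsMadFamily A) (hN : 0 < N) :
    IsMadFamily (residueCopies A N) := by
  rw [isMadFamily_iff] at hA ⊢
  obtain ⟨hinf, had, hmax⟩ := hA
  refine ⟨?_, ⟨?_, ?_⟩, fun B hB => ?_⟩
  · refine (hinf.image (injective_mul_add hN 0).image_injective.injOn).mono ?_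
    rintro _ ⟨a, ha, rfl⟩
    exact ⟨a, ha, 0, hN, rfl⟩
  · rintro _ ⟨a, ha, i, -, rfl⟩
    exact (had.infinite_of_mem a ha).image (injective_mul_add hN i).injOn
  · rintro _ ⟨a, ha, i, hi, rfl⟩ _ ⟨b, hb, j, hj, rfl⟩ hne
    by_cases hij : i = j
    · subst hij
      rw [← Set.image_inter (injective_mul_add hN i)]
      exact (had.finite_inter a ha b hb fun h => hne (h ▸ rfl)).image _
    · convert Set.finite_empty
      rw [← Set.disjoint_iff_inter_eq_empty]
      refine Set.disjoint_of_subset (image_mul_add_subset hi a) (image_mul_add_subset hj b) ?_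
      exact Set.disjoint_left.2 fun m hm hm' => hij (hm.symm.trans hm')
  · have hcov : B ⊆ ⋃ i ∈ Set.Iio N, (fun k => N * k + i) '' ((fun k => N * k + i) ⁻¹' B) := by
      intro m hm
      have hdiv : N * (m / N) + m % N = m := Nat.div_add_mod m N
      exact Set.mem_biUnion (show m % N ∈ Set.Iio N from Nat.mod_lt m hN)
        ⟨m / N, by simpa [hdiv] using hm, hdiv⟩
    obtain ⟨i, hi, hBi⟩ : ∃ i ∈ Set.Iio N, ((fun k => N * k + i) ⁻¹' B).Infinite := by
      by_contra! hcon
      exact hB (((Set.finite_Iio N).biUnion fun i hi =>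
        (hcon i hi).image _).subset hcov)
    exact ((hmax _ hBi).image _).mono (image_subset_familyTrace_residueCopies hN hi B)

theorem HasTrueCardinalityContinuum.residueCopies (hA : HasTrueCardinalityContinuum A)
    (hN : 0 < N) : HasTrueCardinalityContinuum (residueCopies A N) := by
  rw [hasTrueCardinalityContinuum_iff] at hA ⊢
  intro B hB
  rw [familyTrace_residueCopies hN] at hB
  obtain ⟨i, hi, hBi⟩ : ∃ i ∈ Set.Iio N,
      (familyTrace A ((fun k => N * k + i) ⁻¹' B)).Infinite := by
    by_contra! hcon
    exact hB ((Set.finite_Iio N).biUnion fun i hi => (hcon i hi).image _)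
  refine (hA _ hBi).trans ?_
  rw [← Cardinal.mk_image_eq (injective_mul_add hN i).image_injective]
  exact Cardinal.mk_le_mk_of_subset (image_subset_familyTrace_residueCopies hN hi B)

theorem infinite_familyTrace_residueCopies (hA : IsMadFamily A) {i : ℕ} (hi : i < N) :
    (familyTrace (residueCopies A N) {m | m % N = i}).Infinite := by
  have hN := Nat.zero_lt_of_lt hi
  refine (hA.1.image (injective_mul_add hN i).image_injective.injOn).mono ?_
  rintro _ ⟨a, ha, rfl⟩
  refine ⟨⟨a, ha, i, hi, rfl⟩, ?_⟩
  rw [Set.inter_eq_left.2 (image_mul_add_subset hi a)]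
  exact (hA.2.prop.infinite_of_mem a ha).image (injective_mul_add hN i).injOn

/-- Each copy lies inside a single class, so a union of few copies cannot reach all classes. -/
theorem eq_of_infinite_inter_of_mem_residueCopies {c : Set ℕ} (hc : c ∈ residueCopies A N)
    {i j : ℕ} (hi : (c ∩ {m | m % N = i}).Infinite) (hj : (c ∩ {m | m % N = j}).Infinite) :
    i = j := by
  obtain ⟨a, -, l, hl, rfl⟩ := hc
  obtain ⟨x, hx, hxi⟩ := hi.nonempty
  obtain ⟨y, hy, hyj⟩ := hj.nonempty
  exact hxi.symm.trans ((image_mul_add_subset hl a hx).trans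
    ((image_mul_add_subset hl a hy).symm.trans hyj))

end Copies

/-! ### Amalgamating finite blocks -/

section Amalgam

/-- The union of the members of `A` with the same label as `a`. -/
def amalgamOf {Q : Type*} (A : Set (Set ℕ)) (p : Set ℕ → Q) (a : Set ℕ) : Set ℕ :=
  ⋃₀ {b | b ∈ A ∧ p b = p a}

/-- The family obtained from `A` by uniting the members that carry the same label. -/
def amalgam {Q : Type*} (A : Set (Set ℕ)) (p : Set ℕ → Q) : Set (Set ℕ) :=
  amalgamOf A p '' A

variable {Q : Type*} {A : Set (Set ℕ)} {p : Set ℕ → Q}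

theorem amalgamOf_congr {a b : Set ℕ} (h : p a = p b) : amalgamOf A p a = amalgamOf A p b := by
  rw [amalgamOf, h, amalgamOf]

theorem subset_amalgamOf {a b : Set ℕ} (hb : b ∈ A) (h : p b = p a) : b ⊆ amalgamOf A p a :=
  Set.subset_sUnion_of_mem (show b ∈ {b | b ∈ A ∧ p b = p a} from ⟨hb, h⟩)

/-- A finite union meets `B` infinitely only if one of its pieces does. Hence finite blocks preserve
madness and traces. -/
theorem infinite_amalgamOf_inter_iff {a : Set ℕ} (hfin : {b | b ∈ A ∧ p b = p a}.Finite)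
    (B : Set ℕ) : (amalgamOf A p a ∩ B).Infinite ↔ ∃ b ∈ A, p b = p a ∧ (b ∩ B).Infinite := by
  refine ⟨fun h => ?_, fun ⟨b, hb, hba, h⟩ =>
    h.mono (Set.inter_subset_inter_left _ (subset_amalgamOf hb hba))⟩
  by_contra! hcon
  refine h ?_
  rw [amalgamOf, Set.sUnion_eq_biUnion, Set.iUnion₂_inter]
  exact hfin.biUnion fun b hb => hcon b hb.1 hb.2

theorem familyTrace_amalgam (hfin : ∀ a ∈ A, {b | b ∈ A ∧ p b = p a}.Finite) (B : Set ℕ) :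
    familyTrace (amalgam A p) B = amalgamOf A p '' familyTrace A B := by
  ext c
  constructor
  · rintro ⟨⟨a, ha, rfl⟩, h⟩
    obtain ⟨b, hb, hba, h⟩ := (infinite_amalgamOf_inter_iff (hfin a ha) B).1 h
    exact ⟨b, ⟨hb, h⟩, amalgamOf_congr hba⟩
  · rintro ⟨a, ⟨ha, h⟩, rfl⟩
    exact ⟨⟨a, ha, rfl⟩, (infinite_amalgamOf_inter_iff (hfin a ha) B).2 ⟨a, ha, rfl, h⟩⟩

theorem finite_amalgamOf_inter (hA : IsAlmostDisjointFamily A)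
    (hfin : ∀ a ∈ A, {b | b ∈ A ∧ p b = p a}.Finite) {a b : Set ℕ} (ha : a ∈ A) (hb : b ∈ A)
    (hab : p a ≠ p b) : (amalgamOf A p a ∩ amalgamOf A p b).Finite := by
  by_contra h
  obtain ⟨c, hc, hca, h⟩ := (infinite_amalgamOf_inter_iff (hfin a ha) _).1 h
  rw [Set.inter_comm] at h
  obtain ⟨d, hd, hdb, h⟩ := (infinite_amalgamOf_inter_iff (hfin b hb) _).1 h
  exact h (hA.finite_inter d hd c hc fun e => hab (by rw [← hca, ← hdb, e]))

theorem eq_of_amalgamOf_eq (hA : IsAlmostDisjointFamily A)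
    (hfin : ∀ a ∈ A, {b | b ∈ A ∧ p b = p a}.Finite) {a b : Set ℕ} (ha : a ∈ A) (hb : b ∈ A)
    (hab : amalgamOf A p a = amalgamOf A p b) : p a = p b := by
  by_contra h
  have := finite_amalgamOf_inter hA hfin ha hb h
  rw [← hab, Set.inter_self] at this
  exact hA.infinite_of_mem a ha (this.subset (subset_amalgamOf ha rfl))

theorem finite_amalgamOf_fiber (hA : IsAlmostDisjointFamily A)
    (hfin : ∀ a ∈ A, {b | b ∈ A ∧ p b = p a}.Finite) (c : Set ℕ) :
    {a | a ∈ A ∧ amalgamOf A p a = c}.Finite := by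
  rcases Set.eq_empty_or_nonempty {a | a ∈ A ∧ amalgamOf A p a = c} with h | ⟨a, ha, rfl⟩
  · exact h ▸ Set.finite_empty
  · exact (hfin a ha).subset fun b hb => ⟨hb.1, eq_of_amalgamOf_eq hA hfin hb.1 ha hb.2⟩

theorem infinite_image_amalgamOf (hA : IsAlmostDisjointFamily A)
    (hfin : ∀ a ∈ A, {b | b ∈ A ∧ p b = p a}.Finite) {S : Set (Set ℕ)} (hSA : S ⊆ A)
    (hS : S.Infinite) : (amalgamOf A p '' S).Infinite := by
  intro h
  refine hS ((h.biUnion fun c _ => finite_amalgamOf_fiber hA hfin c).subset fun a ha => ?_)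
  exact Set.mem_biUnion (Set.mem_image_of_mem _ ha) ⟨hSA ha, rfl⟩

theorem IsMadFamily.amalgam (hA : IsMadFamily A)
    (hfin : ∀ a ∈ A, {b | b ∈ A ∧ p b = p a}.Finite) : IsMadFamily (amalgam A p) := by
  rw [isMadFamily_iff] at hA ⊢
  obtain ⟨hinf, had, hmax⟩ := hA
  refine ⟨infinite_image_amalgamOf had hfin subset_rfl hinf, ⟨?_, ?_⟩, fun B hB => ?_⟩
  · rintro _ ⟨a, ha, rfl⟩
    exact (had.infinite_of_mem a ha).mono (subset_amalgamOf ha rfl)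
  · rintro _ ⟨a, ha, rfl⟩ _ ⟨b, hb, rfl⟩ hne
    exact finite_amalgamOf_inter had hfin ha hb fun h => hne (amalgamOf_congr h)
  · rw [familyTrace_amalgam hfin]
    exact (hmax B hB).image _

/-- Amalgamation is finite-to-one, so it cannot lower the cardinality of an infinite trace: a
smaller image would force an infinite fibre. -/
theorem HasTrueCardinalityContinuum.amalgam (hc : HasTrueCardinalityContinuum A)
    (hA : IsAlmostDisjointFamily A) (hfin : ∀ a ∈ A, {b | b ∈ A ∧ p b = p a}.Finite) :
    HasTrueCardinalityContinuum (amalgam A p) := by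
  rw [hasTrueCardinalityContinuum_iff] at hc ⊢
  intro B hB
  rw [familyTrace_amalgam hfin] at hB ⊢
  refine (hc B hB.of_image).trans ?_
  by_contra! hlt
  have : Infinite (familyTrace A B) := hB.of_image.to_subtype
  obtain ⟨⟨c, hcB⟩, hinf⟩ := Cardinal.exists_infinite_fiber
    (fun a : familyTrace A B => (⟨amalgamOf A p a, a, a.2, rfl⟩ : amalgamOf A p '' familyTrace A B))
    hlt
  refine Set.infinite_coe_iff.1 hinf (Set.Finite.of_finite_image (f := Subtype.val)
    ((finite_amalgamOf_fiber hA hfin c).subset ?_) Subtype.val_injective.injOn)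
  rintro _ ⟨a, ha, rfl⟩
  exact ⟨a.2.1, congrArg Subtype.val ha⟩

end Amalgam

/-! ### The combinatorial family -/

/-- A mad family of true cardinality `𝔠` can be amalgamated into blocks of at most `m` members in
such a way that any `m` sets with infinite traces have a common member in their traces. -/
theorem exists_label_forall_exists_infinite_inter {A : Set (Set ℕ)}
    (hc : HasTrueCardinalityContinuum A) {m : ℕ} (hm : 0 < m) :
    ∃ p : Set ℕ → (Fin m → Set ℕ) ⊕ Set ℕ,
      (∀ a ∈ A, {b | b ∈ A ∧ p b = p a}.encard ≤ m) ∧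
      ∀ V : Fin m → Set ℕ, (∀ j, (familyTrace A (V j)).Infinite) →
        ∃ a ∈ A, ∀ j, ∃ b ∈ A, p b = p a ∧ (b ∩ V j).Infinite := by
  classical
  let T := {V : Fin m → Set ℕ // ∀ j, (familyTrace A (V j)).Infinite}
  have hT : #(T × Fin m) ≤ 𝔠 := by
    have h1 : #T ≤ 𝔠 := by
      refine (Cardinal.mk_subtype_le _).trans ?_
      have : #(Fin m → Set ℕ) = 𝔠 ^ m := by simp
      rw [this]
      exact Cardinal.power_nat_le Cardinal.aleph0_le_continuum
    rw [Cardinal.mk_prod, Cardinal.lift_id, Cardinal.lift_id]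
    refine (mul_le_mul' h1 ((Cardinal.mk_le_aleph0).trans Cardinal.aleph0_le_continuum)).trans ?_
    simp
  obtain ⟨f, hf, hfmem⟩ := Cardinal.exists_injective_forall_mem
    (fun t : T × Fin m => familyTrace A (t.1.1 t.2))
    fun t => hT.trans (hasTrueCardinalityContinuum_iff.1 hc _ (t.1.2 t.2))
  -- A chosen member is labelled by the tuple it was chosen for; any other set is its own label and
  -- stays a singleton block.
  let p : Set ℕ → (Fin m → Set ℕ) ⊕ Set ℕ := fun a =>
    if h : ∃ t, f t = a then Sum.inl h.choose.1.1 else Sum.inr a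
  have hp : ∀ t, p (f t) = Sum.inl t.1.1 := by
    intro t
    have h : ∃ s, f s = f t := ⟨t, rfl⟩
    have ht : h.choose = t := hf h.choose_spec
    simp only [p, dif_pos h, ht]
  have hp' : ∀ a, (¬ ∃ t, f t = a) → p a = Sum.inr a := fun a h => dif_neg h
  refine ⟨p, fun a _ => ?_, fun V hV => ?_⟩
  · by_cases h : ∃ t, f t = a
    · obtain ⟨⟨t, j⟩, rfl⟩ := h
      have hsub : {b | b ∈ A ∧ p b = p (f (t, j))} ⊆ Set.range fun i => f (t, i) := by
        rintro b ⟨-, hb⟩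
        rw [hp] at hb
        by_cases h : ∃ s, f s = b
        · obtain ⟨⟨s, i⟩, rfl⟩ := h
          rw [hp] at hb
          obtain rfl : s = t := Subtype.ext (Sum.inl.inj hb)
          exact ⟨i, rfl⟩
        · rw [hp' b h] at hb
          cases hb
      refine (Set.encard_le_encard hsub).trans ?_
      rw [← Set.image_univ]
      refine (Set.encard_image_le _ _).trans ?_
      simp
    · have hsub : {b | b ∈ A ∧ p b = p a} ⊆ {a} := by
        rintro b ⟨-, hb⟩
        rw [hp' a h] at hb
        by_cases h : ∃ s, f s = b
        · obtain ⟨s, rfl⟩ := h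
          rw [hp] at hb
          cases hb
        · rw [hp' b h] at hb
          exact Sum.inr.inj hb
      refine (Set.encard_le_encard hsub).trans ?_
      rw [Set.encard_singleton]
      exact_mod_cast hm
  · let t : T := ⟨V, hV⟩
    refine ⟨f (t, ⟨0, hm⟩), (hfmem (t, ⟨0, hm⟩)).1, fun j => ⟨f (t, j), (hfmem (t, j)).1, ?_,
      (hfmem (t, j)).2⟩⟩
    rw [hp, hp]

/-- Sets `W i` with infinite traces on a mad family, no member of which meets all of them, while
fewer sets with infinite traces always have a common member in their traces. -/
theorem exists_isMadFamily_forall_exists_infinite_inter {A : Set (Set ℕ)} (hA : IsMadFamily A)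
    (hc : HasTrueCardinalityContinuum A) {m : ℕ} (hm : 0 < m) :
    ∃ B : Set (Set ℕ), IsMadFamily B ∧ HasTrueCardinalityContinuum B ∧
      (∀ V : Fin m → Set ℕ, (∀ j, (familyTrace B (V j)).Infinite) →
        ∃ b ∈ B, ∀ j, (b ∩ V j).Infinite) ∧
      ∃ W : Fin (m + 1) → Set ℕ, (∀ i, (familyTrace B (W i)).Infinite) ∧
        Pairwise (Function.onFun Disjoint W) ∧ ∀ b ∈ B, ∃ i, (b ∩ W i).Finite := by
  have hN : 0 < m + 1 := m.succ_pos
  have hA' := hA.residueCopies hN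
  have had := hA'.2.prop
  obtain ⟨p, hcard, hp⟩ := exists_label_forall_exists_infinite_inter (hc.residueCopies hN) hm
  have hfin : ∀ a ∈ residueCopies A (m + 1),
      {b | b ∈ residueCopies A (m + 1) ∧ p b = p a}.Finite := fun a ha =>
    Set.finite_of_encard_le_coe (hcard a ha)
  refine ⟨amalgam (residueCopies A (m + 1)) p, hA'.amalgam hfin,
    (hc.residueCopies hN).amalgam had hfin, fun V hV => ?_,
    fun i => {k | k % (m + 1) = i}, fun i => ?_, fun i j hij => ?_, ?_⟩
  · simp only [familyTrace_amalgam hfin] at hV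
    obtain ⟨a, ha, h⟩ := hp V fun j => (hV j).of_image
    exact ⟨_, ⟨a, ha, rfl⟩, fun j => (infinite_amalgamOf_inter_iff (hfin a ha) _).2 (h j)⟩
  · rw [familyTrace_amalgam hfin]
    exact infinite_image_amalgamOf had hfin (fun a ha => ha.1)
      (infinite_familyTrace_residueCopies hA i.2)
  · exact Set.disjoint_left.2 fun k hk hk' => hij (Fin.ext (hk.symm.trans hk'))
  · rintro _ ⟨a, ha, rfl⟩
    -- Otherwise the block has a piece for each of the `m + 1` classes. These pieces are distinct,
    -- against the bound `m`.
    by_contra! hcon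
    have hmeet := fun i : Fin (m + 1) => (infinite_amalgamOf_inter_iff (hfin a ha) _).1 (hcon i)
    choose g hgA hgp hg using hmeet
    have hginj : Function.Injective g := fun i j hij =>
      Fin.ext (eq_of_infinite_inter_of_mem_residueCopies (hgA i) (hg i) (hij ▸ hg j))
    have hle : (Set.range g).encard ≤ m :=
      (Set.encard_le_encard (t := {b | b ∈ residueCopies A (m + 1) ∧ p b = p a})
        (Set.range_subset_iff.2 fun i => ⟨hgA i, hgp i⟩)).trans (hcard a ha)
    rw [← Set.image_univ, hginj.encard_image, Set.encard_univ, ENat.card_eq_coe_fintype_card,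
      Fintype.card_fin] at hle
    exact absurd (ENat.natCast_le_natCast.1 hle) (by omega)

/-! ### Topology of the Mrówka–Isbell space -/

namespace PsiSpace

variable {A : Set (Set ℕ)}

theorem isOpen_iff {U : Set (PsiSpace A)} :
    IsOpen U ↔ ∀ a : A, mem a ∈ U → ((a : Set ℕ) \ nat ⁻¹' U).Finite := by
  refine forall₂_congr fun a _ => ⟨fun ⟨F, hF⟩ => F.finite_toSet.subset fun k hk => ?_,
    fun h => ⟨h.toFinset, fun k hk hkF => ?_⟩⟩
  · by_contra hkF
    exact hk.2 (hF k hk.1 hkF)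
  · by_contra hkU
    exact hkF (h.mem_toFinset.2 ⟨hk, hkU⟩)

theorem isClosed_iff {C : Set (PsiSpace A)} :
    IsClosed C ↔ ∀ a : A, ((a : Set ℕ) ∩ nat ⁻¹' C).Infinite → mem a ∈ C := by
  rw [← isOpen_compl_iff, isOpen_iff]
  refine forall_congr' fun a => ?_
  rw [Set.preimage_compl, Set.sdiff_compl, Set.Infinite, not_imp_comm, Set.mem_compl_iff]

/-- The closure in `PsiSpace A` of a set `V` of isolated points. -/
def closureNat (A : Set (Set ℕ)) (V : Set ℕ) : Set (PsiSpace A) :=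
  {x | match x with
    | nat k => k ∈ V
    | mem a => ((a : Set ℕ) ∩ V).Infinite}

theorem closureNat_eq_closure (V : Set ℕ) : closureNat A V = closure (nat '' V) := by
  refine Set.Subset.antisymm ?_ (closure_minimal ?_ (isClosed_iff.2 fun a ha => ha))
  · have hcl := isClosed_iff.1 (isClosed_closure (s := (nat '' V : Set (PsiSpace A))))
    rintro (k | a) h
    · exact subset_closure ⟨k, h, rfl⟩
    · exact hcl a (Set.Infinite.mono
        (Set.inter_subset_inter_right _ fun k hk => subset_closure ⟨k, hk, rfl⟩) h)
  · rintro _ ⟨k, hk, rfl⟩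
    exact hk

theorem isOpen_image_nat (V : Set ℕ) : IsOpen (nat '' V : Set (PsiSpace A)) := by
  refine isOpen_iff.2 fun a ha => ?_
  obtain ⟨k, -, hk⟩ := ha
  cases hk

theorem isRegularlyClosed_closureNat (V : Set ℕ) : IsRegularlyClosed (closureNat A V) := by
  rw [closureNat_eq_closure, IsRegularlyClosed]
  refine Set.Subset.antisymm (closure_mono ?_) (closure_minimal interior_subset isClosed_closure)
  exact interior_maximal subset_closure (isOpen_image_nat V)

theorem _root_.IsRegularlyClosed.isClosed {X : Type*} [TopologicalSpace X] {C : Set X}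
    (hC : IsRegularlyClosed C) : IsClosed C := by
  rw [IsRegularlyClosed] at hC
  exact hC ▸ isClosed_closure

/-- Almost all of `a` lies in any open set containing the point `mem a`, so `interior C` is
contained in the closure of the isolated points of `C`. -/
theorem mem_mem_iff_of_isRegularlyClosed (hA : IsAlmostDisjointFamily A) {C : Set (PsiSpace A)}
    (hC : IsRegularlyClosed C) (a : A) :
    mem a ∈ C ↔ ((a : Set ℕ) ∩ nat ⁻¹' C).Infinite := by
  refine ⟨fun ha => ?_, isClosed_iff.1 hC.isClosed a⟩
  have hsub : closure (interior C) ⊆ closureNat A (nat ⁻¹' C) := by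
    refine closure_minimal ?_ (isClosed_iff.2 fun a ha => ha)
    rintro (k | b) hb
    · exact interior_subset (s := C) hb
    · intro hfin
      refine hA.infinite_of_mem b b.2 ((hfin.union (isOpen_iff.1 isOpen_interior b hb)).subset ?_)
      intro k hk
      by_cases hkC : k ∈ nat ⁻¹' interior C
      · exact Or.inl ⟨hk, interior_subset (s := C) hkC⟩
      · exact Or.inr ⟨hk, hkC⟩
  rw [hC] at ha
  exact hsub ha

theorem isClopen_singleton_nat (k : ℕ) :
    IsClopen ({nat k} : Set (PsiSpace A)) := by
  refine ⟨isClosed_iff.2 fun a ha => ?_, ?_⟩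
  · refine absurd ((Set.finite_singleton k).subset ?_) ha
    rintro j ⟨-, hj⟩
    exact nat.inj hj
  · rw [← Set.image_singleton]
    exact isOpen_image_nat _

theorem t3Space (hA : IsAlmostDisjointFamily A) : T3Space (PsiSpace A) := by
  have ht1 : T1Space (PsiSpace A) := by
    refine ⟨fun x => isClosed_iff.2 fun a ha => ?_⟩
    refine absurd (Set.Subsingleton.finite fun i hi j hj => ?_) ha
    exact nat.inj (Eq.trans hi.2 (Eq.symm hj.2))
  have hreg : RegularSpace (PsiSpace A) := by
    refine RegularSpace.of_exists_mem_nhds_isClosed_subset fun x s hs => ?_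
    obtain ⟨U, hUs, hU, hxU⟩ := mem_nhds_iff.1 hs
    rcases x with k | a
    · have hk := isClopen_singleton_nat (A := A) k
      exact ⟨{nat k}, hk.2.mem_nhds rfl, hk.1, Set.singleton_subset_iff.2 (hUs hxU)⟩
    · have ha := isOpen_iff.1 hU a hxU
      -- This neighbourhood is closed because any other member meets `a` in a finite set.
      refine ⟨{mem a} ∪ nat '' ((a : Set ℕ) ∩ nat ⁻¹' U), IsOpen.mem_nhds (isOpen_iff.2 ?_)
        (Or.inl rfl), isClosed_iff.2 ?_, ?_⟩
      · rintro b (hb | ⟨k, -, hk⟩)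
        · obtain rfl : b = a := mem.inj hb
          exact ha.subset fun k hk => ⟨hk.1, fun hkU => hk.2 (Or.inr ⟨k, ⟨hk.1, hkU⟩, rfl⟩)⟩
        · cases hk
      · intro b hb
        by_contra hba
        have hne : (b : Set ℕ) ≠ a := fun e => hba (Or.inl (congrArg mem (Subtype.ext e)))
        refine hb ((hA.finite_inter b b.2 a a.2 hne).subset ?_)
        rintro k ⟨hkb, hk | ⟨j, hj, hjk⟩⟩
        · cases hk
        · cases hjk
          exact ⟨hkb, hj.1⟩
      · rintro _ (rfl | ⟨k, hk, rfl⟩)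
        exacts [hUs hxU, hUs hk.2]
  exact {}

/-- Adding to `C` its finitely many members, minus `B`, gives a clopen set: a member outside `C` is
almost disjoint from that finite union. -/
theorem separatedNhds_of_finite (hA : IsAlmostDisjointFamily A) {C B : Set (PsiSpace A)}
    (hC : IsClosed C) (hB : IsClosed B) (hCB : Disjoint C B) (hfin : {a : A | mem a ∈ C}.Finite) :
    SeparatedNhds C B := by
  let U : Set (PsiSpace A) :=
    C ∪ nat '' ((⋃ a ∈ {a : A | mem a ∈ C}, (a : Set ℕ)) \ nat ⁻¹' B)
  have hmem : ∀ a : A, mem a ∈ U → mem a ∈ C := by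
    rintro a (ha | ⟨k, -, hk⟩)
    · exact ha
    · cases hk
  have hopen : IsOpen U := by
    refine isOpen_iff.2 fun a ha => ?_
    have haC := hmem a ha
    have haB : ((a : Set ℕ) ∩ nat ⁻¹' B).Finite := by
      by_contra h
      exact Set.disjoint_left.1 hCB haC (isClosed_iff.1 hB a h)
    refine haB.subset fun k hk => ⟨hk.1, ?_⟩
    by_contra hkB
    exact hk.2 (Or.inr ⟨k, ⟨Set.mem_biUnion haC hk.1, hkB⟩, rfl⟩)
  have hclosed : IsClosed U := by
    refine isClosed_iff.2 fun b hb => ?_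
    by_contra hbU
    have hbC : mem b ∉ C := fun h => hbU (Or.inl h)
    have h1 : ((b : Set ℕ) ∩ nat ⁻¹' C).Finite := by
      by_contra h
      exact hbC (isClosed_iff.1 hC b h)
    have h2 : ((b : Set ℕ) ∩ ⋃ a ∈ {a : A | mem a ∈ C}, (a : Set ℕ)).Finite := by
      rw [Set.inter_iUnion₂]
      refine hfin.biUnion fun a ha => hA.finite_inter b b.2 a a.2 fun e => hbC ?_
      rw [Subtype.ext e]
      exact ha
    refine hb ((h1.union h2).subset ?_)
    rintro k ⟨hkb, hk | ⟨j, hj, hjk⟩⟩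
    · exact Or.inl ⟨hkb, hk⟩
    · cases hjk
      exact Or.inr ⟨hkb, hj.1⟩
  refine ⟨U, Uᶜ, hopen, hclosed.isOpen_compl, Set.subset_union_left, ?_, disjoint_compl_right⟩
  rintro x hxB (hxC | ⟨k, hk, rfl⟩)
  · exact Set.disjoint_left.1 hCB hxC hxB
  · exact hk.2 hxB

theorem finite_mem_of_finite_familyTrace (hA : IsAlmostDisjointFamily A) {C : Set (PsiSpace A)}
    (hC : IsRegularlyClosed C) (hfin : (familyTrace A (nat ⁻¹' C)).Finite) :
    {a : A | mem a ∈ C}.Finite := by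
  refine Set.Finite.of_finite_image (f := Subtype.val) (hfin.subset ?_)
    Subtype.val_injective.injOn
  rintro _ ⟨a, ha, rfl⟩
  exact ⟨a.2, (mem_mem_iff_of_isRegularlyClosed hA hC a).1 ha⟩

/-! ### Partial normality from the trace conditions -/

theorem isPartlyNormalOfOrder (hA : IsAlmostDisjointFamily A) {n : ℕ}
    (h : ∀ V : Fin (n + 1) → Set ℕ, (∀ j, (familyTrace A (V j)).Infinite) →
      ∃ a ∈ A, ∀ j, (a ∩ V j).Infinite) :
    IsPartlyNormalOfOrder n (PsiSpace A) := by
  refine ⟨t3Space hA, ?_⟩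
  rintro C B hC ⟨m, hm1, hmn, D, hD, rfl⟩ hdisj
  have hBcl : IsClosed (⋂ i, D i) := isClosed_iInter fun i => (hD i).isClosed
  by_cases hCfin : (familyTrace A (nat ⁻¹' C)).Finite
  · exact separatedNhds_of_finite hA hC.isClosed hBcl hdisj
      (finite_mem_of_finite_familyTrace hA hC hCfin)
  by_cases hDfin : ∃ i, (familyTrace A (nat ⁻¹' D i)).Finite
  · obtain ⟨i, hi⟩ := hDfin
    refine (separatedNhds_of_finite hA hBcl hC.isClosed hdisj.symm ?_).symm
    exact (finite_mem_of_finite_familyTrace hA (hD i) hi).subset fun a ha =>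
      Set.mem_iInter.1 ha i
  push Not at hDfin
  -- Pads the `m` sets to exactly `n` by repeating the last one; `r` fixes every index below `m`.
  let r : Fin n → Fin m := fun j => ⟨min j (m - 1), by omega⟩
  obtain ⟨a, haA, ha⟩ := h (Fin.cons (nat ⁻¹' C) fun j => nat ⁻¹' D (r j))
    (Fin.cases hCfin fun j => hDfin (r j))
  refine absurd (Set.mem_iInter.2 fun i => ?_) (Set.disjoint_left.1 hdisj
    ((mem_mem_iff_of_isRegularlyClosed hA hC ⟨a, haA⟩).2 (ha 0)))
  have hri : r ⟨i, i.2.trans_le hmn⟩ = i := by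
    apply Fin.ext
    simp only [r]
    omega
  have := ha (Fin.succ ⟨i, i.2.trans_le hmn⟩)
  rw [Fin.cons_succ, hri] at this
  exact (mem_mem_iff_of_isRegularlyClosed hA (hD i) ⟨a, haA⟩).2 this

theorem not_isPartlyNormalOfOrder {n : ℕ} (hn : 1 < n)
    (h : ∀ V : Fin n → Set ℕ, (∀ j, (familyTrace A (V j)).Infinite) →
      ∃ a ∈ A, ∀ j, (a ∩ V j).Infinite)
    {W : Fin (n + 1) → Set ℕ} (hW : ∀ i, (familyTrace A (W i)).Infinite)
    (hdisj : Pairwise (Function.onFun Disjoint W)) (hmeet : ∀ a ∈ A, ∃ i, (a ∩ W i).Finite) :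
    ¬ IsPartlyNormalOfOrder n (PsiSpace A) := by
  intro hnormal
  obtain ⟨U, V, hU, hV, hWU, hWV, hUV⟩ := hnormal.separated (closureNat A (W 0))
    (⋂ i : Fin n, closureNat A (W i.succ)) (isRegularlyClosed_closureNat _)
    ⟨n, by omega, le_rfl, _, fun i => isRegularlyClosed_closureNat _, rfl⟩ (by
      refine Set.disjoint_left.2 ?_
      rintro (k | a) h0 h1 <;> rw [Set.mem_iInter] at h1
      · exact Set.disjoint_left.1 (hdisj (Fin.succ_ne_zero ⟨0, by omega⟩)) (h1 ⟨0, by omega⟩) h0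
      · obtain ⟨i, hi⟩ := hmeet a a.2
        exact Fin.cases (fun hi => h0 hi) (fun i hi => h1 i hi) i hi)
  let u : Set ℕ := nat ⁻¹' U
  let z : Fin n := ⟨0, by omega⟩
  -- One of the two halves of `W 1`, inside or outside `u`, has infinite trace. If it is the inner
  -- half, a member common to it and the remaining `W j` lies in `V`, yet meets `U` infinitely.
  by_cases hu : (familyTrace A (W z.succ ∩ u)).Infinite
  · obtain ⟨a, haA, ha⟩ := h (fun j => if j = z then W z.succ ∩ u else W j.succ) fun j => by
      split_ifs
      exacts [hu, hW _]
    have haz := ha z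
    rw [if_pos rfl] at haz
    have haV : mem ⟨a, haA⟩ ∈ V := by
      refine hWV (Set.mem_iInter.2 fun j => ?_)
      have haj := ha j
      split_ifs at haj with hj
      · rw [hj]
        exact haz.mono (Set.inter_subset_inter_right _ Set.inter_subset_left)
      · exact haj
    refine haz ((isOpen_iff.1 hV _ haV).subset fun k hk => ⟨hk.1, fun hkV => ?_⟩)
    exact Set.disjoint_left.1 hUV hk.2.2 hkV
  · have hu' : (familyTrace A (W z.succ \ u)).Infinite := by
      have := hW z.succ
      rw [← Set.inter_union_sdiff (W z.succ) u, familyTrace_union, Set.infinite_union] at this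
      exact this.resolve_left hu
    -- A member common to the outer half and `W 0` lies in `U`, yet has infinitely many elements
    -- outside `u`. Two slots are needed, hence `1 < n`.
    obtain ⟨a, haA, ha⟩ := h (fun j => if j = z then W z.succ \ u else W 0) fun j => by
      split_ifs
      exacts [hu', hW _]
    have haz := ha z
    rw [if_pos rfl] at haz
    have ha1 := ha ⟨1, hn⟩
    rw [if_neg (by simp [z])] at ha1
    have haU : mem ⟨a, haA⟩ ∈ U := hWU ha1
    exact haz ((isOpen_iff.1 hU _ haU).subset fun k hk => ⟨hk.1, hk.2.2⟩)

end PsiSpace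

theorem corollary2p9
    (h : ∃ A : Set (Set ℕ), IsMadFamily A ∧ HasTrueCardinalityContinuum A)
    (n : ℕ) (hn : 0 < n) :
    ∃ A : Set (Set ℕ), IsMadFamily A ∧ HasTrueCardinalityContinuum A ∧
      IsPartlyNormalOfOrder n (PsiSpace A) ∧ ¬ IsPartlyNormalOfOrder (n + 1) (PsiSpace A) := by
  obtain ⟨A, hA, hc⟩ := h
  obtain ⟨B, hB, hBc, hV, W, hW, hdisj, hmeet⟩ :=
    exists_isMadFamily_forall_exists_infinite_inter hA hc n.succ_pos
  exact ⟨B, hB, hBc, PsiSpace.isPartlyNormalOfOrder hB.2.prop hV,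
    PsiSpace.not_isPartlyNormalOfOrder (Nat.succ_lt_succ hn) hV hW hdisj hmeet⟩
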